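/- A one-tape Turing machine is a tuple $M=(Q,\Sigma,\Gamma,\sqcup,\delta,q_0,q_{\mathrm{acc}},q_{\mathrm{rej}})$, where $Q$ is a finite set of states, $\Gamma$ a finite tape alphabet, $\Sigma\subseteq\Gamma$ a nonempty input alphabet, $\sqcup\in\Gamma\setminus\Sigma$ the blank symbol, $q_0,q_{\mathrm{acc}},q_{\mathrm{rej}}\in Q$ are pairwise distinct, and $\delta$ is a deterministic transition function. The machine has one two-way infinite read-write tape, on which the input is initially written (all other cells being blank) with the head on the first cell of the input (on an arbitrary cell if the input is empty); in each step the head writes a symbol and moves one cell to the left or to the right, and the machine halts when it enters $q_{\mathrm{acc}}$ or $q_{\mathrm{rej}}$. For $T:\mathbb{N}\to\mathbb{R}_{\ge 0}$, the machine $M$ runs in time $T(n)$ if, for each $n\in\mathbb{N}$ and each input $w\in\Sigma^*$ of length $n$, it halts on $w$ after at most $T(n)$ steps. Theorem. Let $T:\mathbb{N}\to\mathbb{R}_{\ge 0}$ be a function (not necessarily computable) such that $T(n)=\Omega(n\log n)$, i.e. there exist $k>0$ and $n_0\in\mathbb{N}$ with $T(n)\ge k\,n\log_2 n$ for all $n\ge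 n_0$, and such that $T(n)\ge n+1$ for all $n\in\mathbb{N}$. Then the problem whether a given one-tape Turing machine runs in time $T(n)$ is undecidable: there is no algorithm that, given the description of an arbitrary one-tape Turing machine $M$, always halts and correctly tells whether $M$ runs in time $T(n)$. -/

import Mathlib

open scoped NNReal

/-- A deterministic one-tape Turing machine `(Q, Σ, Γ, blank, δ, q₀, q_acc, q_rej)`.
The finite sets of states and of tape symbols are `Q = Fin numStates` and `Γ = Fin numSymbols`.
At each step the head moves to the left or to the right (it cannot stay put). The machine stops as
soon as it is in one of the two halting states, so the values of `δ` there are never used. -/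
structure OneTapeTM where
  numStates : ℕ
  numSymbols : ℕ
  inputAlphabet : Finset (Fin numSymbols)
  blank : Fin numSymbols
  δ : Fin numStates → Fin numSymbols → Fin numStates × Fin numSymbols × Turing.Dir
  start : Fin numStates
  accept : Fin numStates
  reject : Fin numStates
  inputAlphabet_nonempty : inputAlphabet.Nonempty
  blank_notMem : blank ∉ inputAlphabet
  start_ne_accept : start ≠ accept
  start_ne_reject : start ≠ reject
  accept_ne_reject : accept ≠ reject

namespace OneTapeTM

/-- A configuration: the state, the position of the head, and the contents of the two-way
infinite tape, whose cells are numbered by the integers. -/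
structure Cfg (M : OneTapeTM) where
  state : Fin M.numStates
  head : ℤ
  tape : ℤ → Fin M.numSymbols

/-- The displacement of the head. -/
def shift : Turing.Dir → ℤ
  | Turing.Dir.left => -1
  | Turing.Dir.right => 1

variable (M : OneTapeTM)

/-- A configuration is halted if its state is the accepting or the rejecting one. -/
def Halted (c : M.Cfg) : Prop := c.state = M.accept ∨ c.state = M.reject

instance (c : M.Cfg) : Decidable (M.Halted c) :=
  inferInstanceAs (Decidable (c.state = M.accept ∨ c.state = M.reject))

/-- One application of the transition function; a halted configuration does not change. -/
def step (c : M.Cfg) : M.Cfg :=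
  if M.Halted c then c
  else
    let r := M.δ c.state (c.tape c.head)
    { state := r.1
      head := c.head + shift r.2.2
      tape := Function.update c.tape c.head r.2.1 }

/-- The tape with the word `w` in the cells `0, …, |w| - 1` and blanks elsewhere. -/
def initTape (w : List (Fin M.numSymbols)) (i : ℤ) : Fin M.numSymbols :=
  if 0 ≤ i then w.getD i.toNat M.blank else M.blank

/-- The initial configuration on the word `w`, with the head on cell `0`. -/
def init (w : List (Fin M.numSymbols)) : M.Cfg where
  state := M.start
  head := 0
  tape := M.initTape w

/-- `M` runs in time `T(n)`: on each input `w`, a word over the input alphabet, it halts after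
at most `T(|w|)` steps. -/
def RunsInTime (T : ℕ → ℝ≥0) : Prop :=
  ∀ w : List (Fin M.numSymbols), (∀ a ∈ w, a ∈ M.inputAlphabet) →
    ∃ k : ℕ, (k : ℝ≥0) ≤ T w.length ∧ M.Halted (M.step^[k] (M.init w))

/-- The data type of descriptions of one-tape Turing machines: number of states, number of
symbols, the input alphabet as a list of truth values, the blank symbol, the transition table, and
the starting, accepting and rejecting states. -/
abbrev Code : Type :=
  ℕ × ℕ × List Bool × ℕ × List (List (ℕ × ℕ × Bool)) × ℕ × ℕ × ℕ

/-- The canonical description of a machine. The truth value in an entry of the transition table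
tells whether the head moves to the right. -/
def encode : Code :=
  (M.numStates, M.numSymbols,
    List.ofFn (fun a : Fin M.numSymbols => decide (a ∈ M.inputAlphabet)),
    (M.blank : ℕ),
    List.ofFn (fun q : Fin M.numStates => List.ofFn (fun a : Fin M.numSymbols =>
      (((M.δ q a).1 : ℕ), ((M.δ q a).2.1 : ℕ), decide ((M.δ q a).2.2 = Turing.Dir.right)))),
    (M.start : ℕ), (M.accept : ℕ), (M.reject : ℕ))

/-- Different machines have different descriptions. -/
theorem encode_injective : Function.Injective encode := by
  rintro ⟨q, g, S, b, d, s, a, r, _, _, _, _, _⟩ ⟨q', g', S', b', d', s', a', r', _, _, _, _, _⟩ h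
  simp only [encode, Prod.mk.injEq] at h
  obtain ⟨rfl, rfl, hS, hb, hd, hs, ha, hr⟩ := h
  have hS' := List.ofFn_injective hS
  have hd' := List.ofFn_injective hd
  obtain rfl : S = S' := by
    ext x; simpa using congrFun hS' x
  obtain rfl : d = d' := by
    funext x y
    have h1 := congrFun (List.ofFn_injective (congrFun hd' x)) y
    simp only [Prod.mk.injEq] at h1
    obtain ⟨h1, h2, h3⟩ := h1
    refine Prod.ext (Fin.ext h1) (Prod.ext (Fin.ext h2) ?_)
    revert h3
    cases (d x y).2.2 <;> cases (d' x y).2.2 <;> simp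
  obtain rfl := Fin.ext hb
  obtain rfl := Fin.ext hs
  obtain rfl := Fin.ext ha
  obtain rfl := Fin.ext hr
  rfl

end OneTapeTM

/-- A problem `L`, a set of one-tape Turing machines, is decidable if there is an algorithm (a
partial recursive function) that, given the description of any one-tape Turing machine, halts and
tells whether the machine belongs to `L`. Nothing is asked of the algorithm on data that do not
describe a machine. -/
def DecidableProblem (L : Set OneTapeTM) : Prop :=
  ∃ f : OneTapeTM.Code →. Bool, Partrec f ∧
    ∀ M : OneTapeTM, ∃ b ∈ f M.encode, (b = true ↔ M ∈ L)

/-- The problem of whether a one-tape Turing machine runs in time `T(n)`. -/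
def HALT₁ (T : ℕ → ℝ≥0) : Set OneTapeTM := {M | M.RunsInTime T}

/-- `f(n) = Ω(g(n))`. -/
def IsBigOmega (f : ℕ → ℝ≥0) (g : ℕ → ℝ) : Prop :=
  ∃ k : ℝ, 0 < k ∧ ∃ n₀ : ℕ, ∀ n ≥ n₀, k * g n ≤ f n

/-!
The complement of a halting problem is reduced to the problem of running in time `T(n)`.

Mathlib's compilation of partial recursive functions to Turing machines provides a single
Post–Turing machine `M` whose halting problem on the words `abc^m` is undecidable
(`exists_TM0_halting_not_computable`). For each `m`, a one-tape machine over a one-letter input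
alphabet is built which runs in time `T(n)` if and only if `M` does not halt on `abc^m`
(`Sweep.runsInTime_iff_not_dom`), and whose description is computable from `m`
(`Sweep.computable_encode_machine`).

This machine first scans its input. If the length `n` is at most a bound depending on `m`, it
accepts after `n + 1` steps. Otherwise it writes `abc^m` on its tape and goes on to sweep
over the tape from one end to the other and back. Each round trip performs one step of `M`, with
the state of `M` kept in the finite control and the head of `M` marked on the tape. The sweeps have
to be counted, which is the task of a sieve: at first all `n` cells are active, and each sweep
to the right leaves only every `B`-th active cell active. The machine accepts when no active
cell is left, that is, after about `log_B n` round trips (`Sweep.Start.halts`). So if `M` runs forever, the total time is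
`O(n log_B n)`, and for large `B` this is below the given multiple of `n log n`
(`Sweep.exists_time_bound`). If `M` halts, then on all long inputs the machine notices this before
the sieve is exhausted, and enters an infinite loop (`Sweep.exists_start_loops`).
-/

/-! ### A Post–Turing machine with an undecidable halting problem -/

section UndecidableHalting

open Turing Turing.PartrecToTM2

theorem trNat_two_pow (m : ℕ) :
    trNat (2 ^ m) = List.replicate m Γ'.bit0 ++ [Γ'.bit1] := by
  have h : ∀ m : ℕ, ∃ p : PosNum, ((2 ^ m : ℕ) : Num) = Num.pos p ∧
      trPosNum p = List.replicate m Γ'.bit0 ++ [Γ'.bit1] := by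
    intro m
    induction m with
    | zero => exact ⟨1, by simp; rfl, rfl⟩
    | succ m ih =>
      obtain ⟨p, hp, hl⟩ := ih
      refine ⟨p.bit0, ?_, by simp [trPosNum, hl, List.replicate_succ]⟩
      rw [pow_succ, Nat.cast_mul, hp, mul_comm, Nat.cast_two]
      have := Num.bit0_of_bit0 (Num.pos p)
      rw [two_mul]
      exact this
  obtain ⟨p, hp, hl⟩ := h m
  rw [trNat, hp]
  exact hl

/-- The halting problem, restricted to inputs that are powers of two. The restriction makes the
binary expansion of the input, least significant digit first, a word of the shape `0 ⋯ 01`. -/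
theorem exists_partrec_two_pow_not_computable :
    ∃ f : ℕ →. ℕ, Partrec f ∧ ¬ ComputablePred fun m : ℕ => (f (2 ^ m)).Dom := by
  classical
  refine ⟨fun x => (Nat.rfind fun k => (Part.some (decide (x ≤ 2 ^ k)) : Part Bool)).bind
    fun k => Nat.Partrec.Code.eval (Denumerable.ofNat Nat.Partrec.Code k) 0, ?_, ?_⟩
  · refine Partrec.bind (Partrec.rfind ?_) ?_
    · refine Computable.partrec (f := fun p : ℕ × ℕ => decide (p.1 ≤ 2 ^ p.2)) ?_
      refine Primrec.to_comp (PrimrecRel.comp (R := (· ≤ ·)) Primrec.nat_le Primrec.fst ?_).decide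
      have h : Primrec₂ ((· ^ ·) : ℕ → ℕ → ℕ) :=
        Primrec₂.unpaired'.1 Nat.Primrec.pow
      exact h.comp (Primrec.const 2) Primrec.snd
    · exact Nat.Partrec.Code.eval_part.comp ((Computable.ofNat _).comp Computable.snd)
        (Computable.const 0)
  · intro h
    refine ComputablePred.halting_problem 0 ?_
    have h' : ComputablePred fun m : ℕ =>
        (Nat.Partrec.Code.eval (Denumerable.ofNat Nat.Partrec.Code m) 0).Dom := by
      refine h.of_eq fun m => ?_
      have : (Nat.rfind fun k => (Part.some (decide (2 ^ m ≤ 2 ^ k)) : Part Bool)) =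
          Part.some m := by
        refine Part.eq_some_iff.2 (Nat.mem_rfind.2 ⟨by simp, fun {k} hk => ?_⟩)
        have : ¬ 2 ^ m ≤ 2 ^ k := by
          rw [Nat.pow_le_pow_iff_right (by norm_num)]; omega
        simpa using this
      change ((Nat.rfind fun k => (Part.some (decide (2 ^ m ≤ 2 ^ k)) : Part Bool)).bind
        fun k => Nat.Partrec.Code.eval (Denumerable.ofNat Nat.Partrec.Code k) 0).Dom ↔ _
      exact iff_of_eq (congrArg (fun p : Part ℕ => (p.bind
        fun k => Nat.Partrec.Code.eval (Denumerable.ofNat Nat.Partrec.Code k) 0).Dom) this |>.trans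
          (by rw [Part.bind_some]))
    obtain ⟨g, hg, hg'⟩ := ComputablePred.computable_iff.1 h'
    refine ComputablePred.computable_iff.2 ⟨fun c => g (Encodable.encode c),
      hg.comp Computable.encode, ?_⟩
    funext c
    have := congrFun hg' (Encodable.encode c)
    simpa using this

/-- A fixed Post–Turing machine `M` with finitely many states and symbols whose halting problem,
on the words `abc^m`, is undecidable. -/
theorem exists_TM0_halting_not_computable :
    ∃ (G P : Type) (_ : Finite G) (_ : Inhabited G) (_ : Finite P) (_ : Inhabited P)
      (M : TM0.Machine G P) (a b c : G),
      ¬ ComputablePred fun m : ℕ => (TM0.eval M (a :: b :: List.replicate m c)).Dom := by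
  classical
  obtain ⟨f, hf, hnc⟩ := exists_partrec_two_pow_not_computable
  obtain ⟨c, hc⟩ := ToPartrec.Code.exists_code
    (Nat.Partrec'.part_iff₁.2 hf)
  -- the default label is the initial one, and Mathlib's own default is not the right one here
  let iΛ : Inhabited Λ' := ⟨trNormal c Cont'.halt⟩
  let M₁ := TM2to1.tr (K := K') (Γ := fun _ => Γ') (σ := Option Γ') tr
  let M₀ := TM1to0.tr M₁
  have hs₂ : TM2.Supports tr (codeSupp c Cont'.halt) := tr_supports c Cont'.halt
  have hs₁ : TM1.Supports M₁ _ := TM2to1.tr_supports tr hs₂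
  have hs₀ := TM1to0.tr_supports M₁ hs₁
  set S := TM1to0.trStmts M₁ (TM2to1.trSupp tr (codeSupp c Cont'.halt)) with hS
  let iS : Inhabited S := ⟨⟨default, hs₀.1⟩⟩
  -- cutting the set of states down to the finite set `S` containing all that can be reached
  let g₁ : PointedMap (TM1to0.Λ' M₁) S :=
    ⟨fun q => if h : q ∈ S then ⟨q, h⟩ else default, by
      have := hs₀.1
      simp only [Finset.mem_coe] at this
      rw [dif_pos this]; rfl⟩
  let i : PointedMap (TM2to1.Γ' K' fun _ => Γ') (TM2to1.Γ' K' fun _ => Γ') := ⟨id, rfl⟩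
  let one : Γ' → TM2to1.Γ' K' (fun _ => Γ') :=
    fun x => (false, Function.update (fun _ => none) K'.main (some x))
  let bot : TM2to1.Γ' K' (fun _ => Γ') :=
    (true, Function.update (fun _ => none) K'.main (some Γ'.cons))
  have hK : Finite K' := by
    refine Finite.of_injective
      (fun k : K' => (K'.rec 0 1 2 3 k : Fin 4)) ?_
    rintro (_ | _ | _ | _) (_ | _ | _ | _) h <;> first | rfl | (exact absurd h (by decide))
  have hG : Finite (TM2to1.Γ' K' fun _ => Γ') :=
    inferInstanceAs (Finite (Bool × (K' → Option Γ')))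
  refine ⟨TM2to1.Γ' K' (fun _ => Γ'), S, hG, inferInstance, inferInstance, iS,
    TM0.Machine.map M₀ i i g₁ Subtype.val, bot, one Γ'.bit1, one Γ'.bit0, ?_⟩
  intro hcomp
  refine hnc (hcomp.of_eq fun m => ?_)
  -- the tape holds the stack from the bottom to the top, and the bottom cell is marked
  have hin : bot :: one Γ'.bit1 :: List.replicate m (one Γ'.bit0) =
      TM2to1.trInit K'.main (trList [2 ^ m]) := by
    have hr : (trList [2 ^ m]).reverse = Γ'.cons :: Γ'.bit1 :: List.replicate m Γ'.bit0 := by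
      simp [trNat_two_pow]
    have hm : List.replicate m (one Γ'.bit0) = (List.replicate m Γ'.bit0).map one :=
      List.map_replicate.symm
    rw [TM2to1.trInit, hr, hm]
    rfl
  refine (iff_of_eq (congrArg (fun l => (TM0.eval _ l).Dom) hin)).trans ?_
  set l := TM2to1.trInit (Γ := fun _ => Γ') K'.main (trList [2 ^ m]) with hl
  have e₁ : (TM0.eval (TM0.Machine.map M₀ i i g₁ Subtype.val) l).Dom ↔ (TM0.eval M₀ l).Dom := by
    refine StateTransition.tr_eval_dom (TM0.Machine.map_respects M₀ i i g₁ Subtype.val hs₀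
      (fun _ => rfl) ?_) ⟨hs₀.1, ?_⟩
    · intro q hq
      change ((if h : q ∈ S then (⟨q, h⟩ : S) else default) : S).1 = q
      rw [dif_pos (by simpa using hq)]
    · rw [TM0.map_init]
      congr 1
      exact List.map_id _
  rw [e₁, TM1to0.tr_eval]
  refine (TM2to1.tr_eval_dom (Γ := fun _ => Γ') tr K'.main (trList [2 ^ m])).trans ?_
  have e₂ : (TM2.eval (Γ := fun _ => Γ') tr K'.main (trList [2 ^ m])).Dom ↔
      (StateTransition.eval (TM2.step tr) (init c [2 ^ m])).Dom := by
    have : (TM2.init K'.main (trList [2 ^ m]) : TM2.Cfg (fun _ => Γ') Λ' (Option Γ')) =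
        init c [2 ^ m] := by
      unfold TM2.init init
      congr 1
      funext k
      cases k <;> rfl
    rw [← this]
    rfl
  have e₃ : ToPartrec.Code.eval c [2 ^ m] = pure <$> f (2 ^ m) :=
    hc (2 ^ m ::ᵥ List.Vector.nil)
  refine e₂.trans ?_
  rw [tr_eval, e₃]
  rfl

end UndecidableHalting

/-! ### The sweeping machine -/

namespace Sweep

open Turing

/-- The progress of the simulated machine within one round trip of the sweeping head.
`todo`: the current step has not been started; `pend`: the simulated head has just been lifted and
has to be put down on the next cell; `back`: the step is a move to the left, to be carried out on
the way back; `done`: the step is finished. -/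
inductive Mode
  | todo | pend | back | done
  deriving DecidableEq

instance : Fintype Mode := ⟨{.todo, .pend, .back, .done}, by rintro (_ | _ | _ | _) <;> decide⟩

/-- Tape symbols of the sweeping machine. A cell `cell a h g` stores whether it is still active as
an element of the sieve, whether the simulated head stands on it, and a symbol `g` of the
simulated tape. -/
inductive Sym (G : Type)
  | blank | inp
  | cell (active mark : Bool) (g : G)
  deriving Fintype

/-- The states that do not depend on the initial word of the simulated machine. In `fill` the rest
of the input is replaced by active cells holding simulated blanks. In `right` and `left`
the head is sweeping over the tape, the state of the simulated machine being `p`. In `right`,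
moreover, `c` counts active cells modulo `B`, and `f` tells whether an active cell has
been met. -/
inductive Ctl (P : Type) (B : ℕ)
  | acc | rej | loop | fill
  | right (md : Mode) (p : P) (c : Fin B) (f : Bool)
  | left (md : Mode) (p : P)
  deriving Fintype

/-- A configuration of a one-tape machine over arbitrary types of states and symbols. -/
structure Config (Q S : Type) where
  state : Q
  head : ℤ
  tape : ℤ → S

variable {G P : Type} {B : ℕ}

/-- One sieving step: of the active cells, only every `B`-th one stays active. -/
def sieve (c : Fin B) (a : Bool) : Fin B × Bool :=
  if a then
    if h : (c : ℕ) + 1 < B then (⟨c + 1, h⟩, false)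
    else (⟨0, c.pos⟩, true)
  else (c, false)

theorem sieve_spec (c : Fin B) (a : Bool) :
    ((sieve c a).1 : ℕ) + B * (sieve c a).2.toNat = c + a.toNat := by
  have := c.isLt
  unfold sieve
  split_ifs with h1 h2 <;> (simp_all; try omega)

variable [Inhabited G] [Inhabited P]

/-- The transitions of the sweeping machine, apart from those of its initial phase. The sweep to
the right performs one step of the simulated machine `M`, except that a move to the left is
postponed to the way back; if `M` halts, the state `loop` is entered, which is never left. A sweep
to the right that met no active cell ends in the accepting state. A blank that is met while the
simulated head is lifted is turned into a cell. The values on combinations of states and symbols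
that do not occur in a computation are arbitrary, as are those in the degenerate case `B = 0`. -/
def ctlTrans (M : TM0.Machine G P) : Ctl P B → Sym G → Ctl P B × Sym G × Dir
  | .right .pend p c f, .blank => (.right .done p c f, .cell false true default, .right)
  | .right md p _ f, .blank => (if f then .left md p else .acc, .blank, .left)
  | .right md p c f, .cell a h g =>
    let c' := (sieve c a).1
    let a' := (sieve c a).2
    let f' := f || a
    match md, h with
    | .pend, _ => (.right .done p c' f', .cell a' true g, .right)
    | .todo, true =>
      match M p g with
      | none => (.loop, .cell a' true g, .right)
      | some (p', .write g') => (.right .done p' c' f', .cell a' true g', .right)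
      | some (p', .move .right) => (.right .pend p' c' f', .cell a' false g, .right)
      | some (p', .move .left) => (.right .back p' c' f', .cell a' true g, .right)
    | md, h => (.right md p c' f', .cell a' h g, .right)
  | .left .pend p, .blank => (.left .done p, .cell false true default, .left)
  | .left _ p, .blank =>
    if h : 0 < B then (.right .todo p ⟨0, h⟩ false, .blank, .right) else (.loop, .blank, .right)
  | .left md p, .cell a h g =>
    match md, h with
    | .pend, _ => (.left .done p, .cell a true g, .left)
    | .back, true => (.left .pend p, .cell a false g, .left)
    | md, h => (.left md p, .cell a h g, .left)
  | .fill, .inp => (.fill, .cell true false default, .right)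
  | .fill, s => (.left .done default, s, .left)
  | _, s => (.loop, s, .right)

/-- The transitions of the initial phase, which scans the first `N + 1` letters of the input and
replaces them by the symbols `w 0, …, w N` of the simulated tape. Shorter inputs are accepted. -/
def chainTrans (N : ℕ) (w : ℕ → G) (i : Fin (N + 1)) :
    Sym G → (Ctl P B ⊕ Fin (N + 1)) × Sym G × Dir
  | .inp => (if h : (i : ℕ) + 1 < N + 1 then .inr ⟨i + 1, h⟩ else .inl .fill,
      .cell true (decide ((i : ℕ) = 0)) (w i), .right)
  | s => (.inl .acc, s, .right)

/-- The transition function of the sweeping machine. -/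
def trans (M : TM0.Machine G P) (N : ℕ) (w : ℕ → G) :
    Ctl P B ⊕ Fin (N + 1) → Sym G → (Ctl P B ⊕ Fin (N + 1)) × Sym G × Dir
  | .inl q, s => ((.inl (ctlTrans M q s).1), (ctlTrans M q s).2)
  | .inr i, s => chainTrans N w i s

variable (M : TM0.Machine G P) (N : ℕ) (w : ℕ → G)

/-- A state of the sweeping machine is halting if it is the accepting or the rejecting one. -/
def IsHalt (q : Ctl P B ⊕ Fin (N + 1)) : Prop := q = .inl .acc ∨ q = .inl .rej

open scoped Classical in
/-- One step of the sweeping machine; a halted configuration does not change. -/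
noncomputable def step (c : Config (Ctl P B ⊕ Fin (N + 1)) (Sym G)) :
    Config (Ctl P B ⊕ Fin (N + 1)) (Sym G) :=
  if IsHalt N c.state then c
  else
    let r := trans M N w c.state (c.tape c.head)
    ⟨r.1, c.head + OneTapeTM.shift r.2.2, Function.update c.tape c.head r.2.1⟩

/-- The tape whose nonblank cells are those in `[l, r)`, with contents given by `A`. -/
def tp (l r : ℤ) (A : ℤ → Bool × Bool × G) : ℤ → Sym G :=
  fun y => if l ≤ y ∧ y < r then .cell (A y).1 (A y).2.1 (A y).2.2 else .blank

/-- `A` has the default value outside `[l, r)`. -/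
def Off (l r : ℤ) (A : ℤ → Bool × Bool × G) : Prop :=
  ∀ y, ¬ (l ≤ y ∧ y < r) → A y = (false, false, default)

/-- The number of active cells in `[l, r)`. -/
noncomputable def act (A : ℤ → Bool × Bool × G) (l r : ℤ) : ℕ :=
  ∑ y ∈ Finset.Ico l r, (A y).1.toNat

/-- `A` describes the simulated tape `T` with the simulated head on cell `i`. -/
def Sync (A : ℤ → Bool × Bool × G) (i : ℤ) (T : Tape G) : Prop :=
  ∀ y, (A y).2 = (decide (y = i), T.nth (y - i))

/-- `A` describes the simulated tape `T` with the simulated head lifted above cell `i`. -/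
def Lifted (A : ℤ → Bool × Bool × G) (i : ℤ) (T : Tape G) : Prop :=
  ∀ y, (A y).2 = (false, T.nth (y - i))

end Sweep

/-! ### Sweeps -/

namespace Sweep

open Turing

section Tape

variable {G : Type} {l r x u v : ℤ} {A : ℤ → Bool × Bool × G}

theorem tp_apply_mem (hl : l ≤ x) (hr : x < r) :
    tp l r A x = .cell (A x).1 (A x).2.1 (A x).2.2 := if_pos ⟨hl, hr⟩

theorem tp_apply_notMem (h : ¬ (l ≤ x ∧ x < r)) : tp l r A x = .blank := if_neg h

theorem update_tp_blank (h : ¬ (l ≤ x ∧ x < r)) :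
    Function.update (tp l r A) x .blank = tp l r A := by
  rw [← tp_apply_notMem (A := A) h, Function.update_eq_self]

theorem update_tp (hl : l ≤ x) (hr : x < r) (a h : Bool) (g : G) :
    Function.update (tp l r A) x (.cell a h g) = tp l r (Function.update A x (a, h, g)) := by
  funext y
  by_cases hy : y = x
  · subst hy; simp [tp, hl, hr]
  · simp [tp, hy]

theorem update_tp_right (hl : l ≤ r) (a h : Bool) (g : G) :
    Function.update (tp l r A) r (.cell a h g) =
      tp l (r + 1) (Function.update A r (a, h, g)) := by
  funext y
  by_cases hy : y = r
  · subst hy; simp [tp, hl]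
  · have : y < r + 1 ↔ y < r := by omega
    simp [tp, hy, this]

theorem update_tp_left (hl : l - 1 < r) (a h : Bool) (g : G) :
    Function.update (tp l r A) (l - 1) (.cell a h g) =
      tp (l - 1) r (Function.update A (l - 1) (a, h, g)) := by
  funext y
  by_cases hy : y = l - 1
  · subst hy; simp [tp, hl]
  · have : l - 1 ≤ y ↔ l ≤ y := by omega
    simp only [tp, Function.update_of_ne hy, this]

theorem Off.update [Inhabited G] (h : Off l r A) {l' r' : ℤ} (hl : l' ≤ l) (hr : r ≤ r')
    (hx : l' ≤ x) (hx' : x < r') (w : Bool × Bool × G) : Off l' r' (Function.update A x w) := by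
  intro y hy
  rw [Function.update_of_ne (by rintro rfl; exact hy ⟨hx, hx'⟩)]
  exact h y fun hh => hy ⟨hl.trans hh.1, hh.2.trans_le hr⟩

theorem act_congr {A' : ℤ → Bool × Bool × G} (h : ∀ y, u ≤ y → y < v → (A y).1 = (A' y).1) :
    act A u v = act A' u v :=
  Finset.sum_congr rfl fun y hy => by
    rw [Finset.mem_Ico] at hy
    rw [h y hy.1 hy.2]

theorem act_update (h : ¬ (u ≤ x ∧ x < v)) (w : Bool × Bool × G) :
    act (Function.update A x w) u v = act A u v :=
  act_congr fun y h1 h2 => by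
    rw [Function.update_of_ne (by rintro rfl; exact h ⟨h1, h2⟩)]

theorem act_self : act A u u = 0 := by simp [act]

theorem act_succ_right (h : u ≤ v) : act A u (v + 1) = act A u v + (A v).1.toNat := by
  unfold act
  rw [show Finset.Ico u (v + 1) = insert v (Finset.Ico u v) by ext y; simp; omega,
    Finset.sum_insert (by simp), add_comm]

theorem act_succ_left (h : u < v) : act A u v = (A u).1.toNat + act A (u + 1) v := by
  unfold act
  rw [show Finset.Ico u v = insert u (Finset.Ico (u + 1) v) by ext y; simp; omega,
    Finset.sum_insert (by simp)]

theorem act_update_same {w : Bool × Bool × G} (h : w.1 = (A x).1) :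
    act (Function.update A x w) u v = act A u v :=
  act_congr fun y _ _ => by
    by_cases hy : y = x
    · subst hy; simp [h]
    · rw [Function.update_of_ne hy]

end Tape

section Clock

variable {G : Type} {B : ℕ}

/-- The state of the sieve when the sweep to the right is about to enter cell `x`, if there were
`a` active cells before the sweep. The number of active cells is a conserved quantity, when those
already passed are weighted with `B` and the counter is taken into account. -/
structure Clock (a : ℕ) (l x r : ℤ) (A : ℤ → Bool × Bool × G) (c : Fin B) (f : Bool) : Prop where
  count : B * act A l x + c + act A x r = a
  idle : f = false → (c : ℕ) = 0 ∧ act A l x = 0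
  pos : f = true → 0 < a

variable {a : ℕ} {l x r : ℤ} {A : ℤ → Bool × Bool × G} {c : Fin B} {f : Bool}

theorem Clock.next (h : Clock a l x r A c f) (hl : l ≤ x) (hr : x < r) (v : Bool × G) :
    Clock a l (x + 1) r (Function.update A x ((sieve c (A x).1).2, v)) (sieve c (A x).1).1
      (f || (A x).1) := by
  have hs := sieve_spec c (A x).1
  have h1 := h.count
  rw [act_succ_left hr] at h1
  constructor
  · rw [act_succ_right hl, act_update (by omega), act_update (by omega), Function.update_self,
      mul_add]
    simp only
    omega
  · intro hf
    rw [Bool.or_eq_false_iff] at hf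
    obtain ⟨h2, h3⟩ := h.idle hf.1
    rw [act_succ_right hl, act_update (by omega), Function.update_self, hf.2]
    simp [sieve, h2, h3]
  · intro hf
    rcases Bool.or_eq_true_iff.1 hf with hf | hf
    · exact h.pos hf
    · rw [hf] at h1
      simp at h1
      omega

theorem Clock.extend (h : Clock a l r r A c f) (hl : l ≤ r) (v : Bool × G) :
    Clock a l (r + 1) (r + 1) (Function.update A r (false, v)) c f := by
  have h1 := h.count
  have h2 : act (Function.update A r (false, v)) l (r + 1) = act A l r := by
    rw [act_succ_right hl, act_update (by omega), Function.update_self]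
    simp
  rw [act_self] at h1
  refine ⟨by rw [h2, act_self]; exact h1, fun hf => ?_, h.pos⟩
  rw [h2]; exact h.idle hf

end Clock

section Step

variable {G P : Type} {B : ℕ} [Inhabited G] [Inhabited P]
  (M : TM0.Machine G P) (N : ℕ) (w : ℕ → G)

theorem step_halt {c : Config (Ctl P B ⊕ Fin (N + 1)) (Sym G)} (h : IsHalt N c.state) :
    step M N w c = c := if_pos h

theorem step_inl {q q' : Ctl P B} {x : ℤ} {t : ℤ → Sym G} {s : Sym G} {d : Dir}
    (h1 : q ≠ .acc) (h2 : q ≠ .rej) (h : ctlTrans M q (t x) = (q', s, d)) :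
    step M N w ⟨.inl q, x, t⟩ =
      ⟨.inl q', x + OneTapeTM.shift d, Function.update t x s⟩ := by
  rw [step, if_neg (by simp [IsHalt, h1, h2])]
  simp [trans, h]

theorem iterate_step_loop {c : Config (Ctl P B ⊕ Fin (N + 1)) (Sym G)}
    (h : c.state = .inl .loop) (n : ℕ) : ((step M N w)^[n] c).state = .inl .loop := by
  induction n generalizing c with
  | zero => exact h
  | succ n ih =>
    rw [Function.iterate_succ_apply]
    refine ih ?_
    rw [step, if_neg (by simp [IsHalt, h])]
    simp [trans, h, ctlTrans]

theorem iterate_step_halt {c : Config (Ctl P B ⊕ Fin (N + 1)) (Sym G)} {m n : ℕ} (hmn : m ≤ n)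
    (h : IsHalt N ((step M N w)^[m] c).state) : (step M N w)^[n] c = (step M N w)^[m] c := by
  obtain ⟨k, rfl⟩ := Nat.exists_eq_add_of_le' hmn
  rw [Function.iterate_add_apply]
  exact Function.iterate_fixed (step_halt M N w h) k

end Step

section RightSweep

variable {G P : Type} {B : ℕ} [Inhabited G] [Inhabited P]

/-- What the mode says about the simulated machine during a sweep to the right that is about to
enter cell `x`; here `C` and `C'` are the simulated configurations before and after the current
step. -/
def RightMode (C C' : TM0.Cfg G P) (l r x : ℤ) (p : P) (A : ℤ → Bool × Bool × G) : Mode → Prop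
  | .todo => p = C.q ∧ ∃ i, x ≤ i ∧ i < r ∧ Sync A i C.Tape
  | .pend => p = C'.q ∧ Lifted A x C'.Tape
  | .back => p = C'.q ∧ C'.Tape = C.Tape.move .left ∧ ∃ i, l ≤ i ∧ i < r ∧ Sync A i C.Tape
  | .done => p = C'.q ∧ ∃ i, l ≤ i ∧ i < r ∧ Sync A i C'.Tape

theorem Sync.update_same {A : ℤ → Bool × Bool × G} {i : ℤ} {T : Tape G} (h : Sync A i T) {x : ℤ}
    {b : Bool} {v : Bool × G} (hv : v = (A x).2) : Sync (Function.update A x (b, v)) i T := by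
  intro y
  by_cases hy : y = x
  · subst hy; rw [Function.update_self, ← h y, hv]
  · rw [Function.update_of_ne hy]; exact h y

theorem Sync.lift {A : ℤ → Bool × Bool × G} {i : ℤ} {T : Tape G} (h : Sync A i T) (b : Bool) :
    ∀ y, (Function.update A i (b, false, (A i).2.2) y).2 = (false, T.nth (y - i)) := by
  intro y
  by_cases hy : y = i
  · subst hy; rw [Function.update_self, h y]
  · rw [Function.update_of_ne hy, h y]; simp [hy]

theorem Lifted.put {A : ℤ → Bool × Bool × G} {i : ℤ} {T : Tape G} (h : Lifted A i T) (b : Bool) :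
    Sync (Function.update A i (b, true, (A i).2.2)) i T := by
  intro y
  by_cases hy : y = i
  · subst hy; rw [Function.update_self, h y]; simp
  · rw [Function.update_of_ne hy, h y]; simp [hy]

theorem Sync.write {A : ℤ → Bool × Bool × G} {i : ℤ} {T : Tape G} (h : Sync A i T) (b : Bool)
    (g : G) : Sync (Function.update A i (b, true, g)) i (T.write g) := by
  intro y
  rw [Tape.write_nth]
  by_cases hy : y = i
  · subst hy; rw [Function.update_self]; simp
  · rw [Function.update_of_ne hy, h y]
    have : y - i ≠ 0 := by omega
    simp [hy, this]

theorem Sync.liftRight {A : ℤ → Bool × Bool × G} {i : ℤ} {T : Tape G} (h : Sync A i T)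
    (b : Bool) :
    Lifted (Function.update A i (b, false, (A i).2.2)) (i + 1) (T.move .right) := by
  intro y
  rw [h.lift b y, Tape.move_right_nth]
  congr 2; ring

theorem Sync.liftLeft {A : ℤ → Bool × Bool × G} {i : ℤ} {T : Tape G} (h : Sync A i T)
    (b : Bool) :
    Lifted (Function.update A i (b, false, (A i).2.2)) (i - 1) (T.move .left) := by
  intro y
  rw [h.lift b y, Tape.move_left_nth]
  congr 2; ring

variable (M : TM0.Machine G P) (N : ℕ) (w : ℕ → G)

/-- The invariant of a sweep to the right over the cells `[l, r)`, about to enter cell `x`. -/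
def RightInv (C C' : TM0.Cfg G P) (a : ℕ) (l r x : ℤ)
    (cfg : Config (Ctl P B ⊕ Fin (N + 1)) (Sym G)) : Prop :=
  ∃ md p c f A, cfg = ⟨.inl (.right md p c f), x, tp l r A⟩ ∧ l ≤ x ∧ Off l r A ∧
    Clock a l x r A c f ∧ RightMode C C' l r x p A md

variable {M N w}

theorem RightInv.next {C C' : TM0.Cfg G P} (hC : TM0.step M C = some C') {a : ℕ} {l r x : ℤ}
    {cfg : Config (Ctl P B ⊕ Fin (N + 1)) (Sym G)} (h : RightInv N C C' a l r x cfg)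
    (hx : x < r) : RightInv N C C' a l r (x + 1) (step M N w cfg) := by
  obtain ⟨md, p, c, f, A, rfl, hl, hoff, hcl, hm⟩ := h
  have hread := tp_apply_mem (A := A) hl hx
  -- the common part of all cases: what the step does to the sieve and to the shape of the tape
  have key : ∀ md' p' h' g',
      ctlTrans M (.right md p c f) (tp l r A x) =
        (.right md' p' (sieve c (A x).1).1 (f || (A x).1),
          .cell (sieve c (A x).1).2 h' g', .right) →
      RightMode C C' l r (x + 1) p' (Function.update A x ((sieve c (A x).1).2, h', g')) md' →
      RightInv N C C' a l r (x + 1) (step M N w ⟨.inl (.right md p c f), x, tp l r A⟩) := by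
    intro md' p' h' g' ht hm'
    refine ⟨md', p', _, _, _, ?_, by omega,
      hoff.update le_rfl le_rfl hl hx ((sieve c (A x).1).2, h', g'), hcl.next hl hx _, hm'⟩
    rw [step_inl M N w (by simp) (by simp) ht, update_tp hl hx]
    rfl
  rcases md with _ | _ | _ | _
  · obtain ⟨rfl, i, hi, hir, hs⟩ := hm
    by_cases hxi : x = i
    · subst hxi
      have hA := hs x
      rw [sub_self, Tape.nth_zero] at hA
      have hA1 : (A x).2.1 = true := by rw [hA]; simp
      have hA2 : (A x).2.2 = C.Tape.1 := by rw [hA]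
      obtain ⟨q, T⟩ := C
      rw [TM0.step, Option.map_eq_some_iff] at hC
      obtain ⟨⟨q', s⟩, hq, rfl⟩ := hC
      rcases s with (_ | _) | g'
      · refine key .back q' true (A x).2.2 ?_ ?_
        · rw [hread]; simp [ctlTrans, hA1, hA2, hq]
        · refine ⟨rfl, rfl, x, hl, hx, hs.update_same ?_⟩
          rw [← hA1]
      · refine key .pend q' false (A x).2.2 ?_ ⟨rfl, hs.liftRight _⟩
        rw [hread]; simp [ctlTrans, hA1, hA2, hq]
      · refine key .done q' true g' ?_ ⟨rfl, x, hl, hx, hs.write _ _⟩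
        rw [hread]; simp [ctlTrans, hA1, hA2, hq]
    · have hA1 : (A x).2.1 = false := by rw [hs x]; simp [hxi]
      refine key .todo C.q false (A x).2.2 ?_ ⟨rfl, i, by omega, hir, hs.update_same ?_⟩
      · rw [hread]; simp [ctlTrans, hA1]
      · rw [← hA1]
  · obtain ⟨rfl, hli⟩ := hm
    refine key .done _ true (A x).2.2 ?_ ⟨rfl, x, hl, hx, hli.put _⟩
    rw [hread]; simp [ctlTrans]
  · obtain ⟨rfl, hT, i, h1, h2, hs⟩ := hm
    refine key .back _ (A x).2.1 (A x).2.2 ?_ ⟨rfl, hT, i, h1, h2, hs.update_same rfl⟩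
    rw [hread]; cases (A x).2.1 <;> simp [ctlTrans]
  · obtain ⟨rfl, i, h1, h2, hs⟩ := hm
    refine key .done _ (A x).2.1 (A x).2.2 ?_ ⟨rfl, i, h1, h2, hs.update_same rfl⟩
    rw [hread]; cases (A x).2.1 <;> simp [ctlTrans]

/-- At the right end of the range the simulated head has been put down again, if necessary on a
new cell. -/
theorem RightInv.finish {C C' : TM0.Cfg G P} {a : ℕ} {l r : ℤ}
    {cfg : Config (Ctl P B ⊕ Fin (N + 1)) (Sym G)} (h : RightInv N C C' a l r r cfg) :
    ∃ e : ℕ, e ≤ 1 ∧ ∃ md p c f A,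
      (step M N w)^[e] cfg = ⟨.inl (.right md p c f), r + e, tp l (r + e) A⟩ ∧ l ≤ r ∧
      Off l (r + e) A ∧ Clock a l (r + e) (r + e) A c f ∧ (md = .back ∨ md = .done) ∧
      RightMode C C' l (r + e) (r + e) p A md := by
  obtain ⟨md, p, c, f, A, rfl, hl, hoff, hcl, hm⟩ := h
  rcases md with _ | _ | _ | _
  · obtain ⟨-, i, hi, hi', -⟩ := hm
    omega
  · obtain ⟨rfl, hli⟩ := hm
    have hA : A r = (false, false, default) := hoff r (by omega)
    refine ⟨1, le_rfl, .done, C'.q, c, f, Function.update A r (false, true, default), ?_, hl,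
      hoff.update le_rfl (by simp) hl (by simp) _, hcl.extend hl _, .inr rfl, rfl, r, hl,
      by simp, ?_⟩
    · have ht : ctlTrans M (.right .pend C'.q c f) (tp l r A r) =
          (.right .done C'.q c f, .cell false true default, .right) := by
        rw [tp_apply_notMem (by omega)]; rfl
      rw [Function.iterate_one, step_inl M N w (by simp) (by simp) ht, update_tp_right hl]
      rfl
    · have := hli.put false
      rwa [hA] at this
  · refine ⟨0, by simp, .back, p, c, f, A, ?_⟩
    simpa using ⟨hl, hoff, hcl, hm⟩
  · refine ⟨0, by simp, .done, p, c, f, A, ?_⟩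
    simpa using ⟨hl, hoff, hcl, hm⟩

end RightSweep

end Sweep

/-! ### Round trips and the initial phase -/

namespace Sweep

open Turing

section LeftSweep

variable {G P : Type} {B : ℕ} [Inhabited G] [Inhabited P]

/-- What the mode says about the simulated machine during a sweep to the left that is about to
enter cell `x`; here `C` and `C'` are the simulated configurations before and after the current
step. -/
def LeftMode (C C' : TM0.Cfg G P) (l r x : ℤ) (p : P) (A : ℤ → Bool × Bool × G) : Mode → Prop
  | .todo => False
  | .pend => p = C'.q ∧ Lifted A x C'.Tape
  | .back => p = C'.q ∧ C'.Tape = C.Tape.move .left ∧ ∃ i, l ≤ i ∧ i ≤ x ∧ Sync A i C.Tape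
  | .done => p = C'.q ∧ ∃ i, l ≤ i ∧ i < r ∧ Sync A i C'.Tape

variable (M : TM0.Machine G P) (N : ℕ) (w : ℕ → G)

/-- The invariant of a sweep to the left over the cells `[l, r)`, about to enter cell `x`. -/
def LeftInv (C C' : TM0.Cfg G P) (a : ℕ) (l r x : ℤ)
    (cfg : Config (Ctl P B ⊕ Fin (N + 1)) (Sym G)) : Prop :=
  ∃ md p A, cfg = ⟨.inl (.left md p), x, tp l r A⟩ ∧ x < r ∧ Off l r A ∧
    act A l r = a ∧ LeftMode C C' l r x p A md

variable {M N w}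

theorem LeftInv.next {C C' : TM0.Cfg G P} {a : ℕ} {l r x : ℤ}
    {cfg : Config (Ctl P B ⊕ Fin (N + 1)) (Sym G)} (h : LeftInv N C C' a l r x cfg)
    (hx : l ≤ x) : LeftInv N C C' a l r (x - 1) (step M N w cfg) := by
  obtain ⟨md, p, A, rfl, hr, hoff, ha, hm⟩ := h
  have hread := tp_apply_mem (A := A) hx hr
  have key : ∀ md' h',
      ctlTrans M (.left md p : Ctl P B) (tp l r A x) =
        (.left md' p, .cell (A x).1 h' (A x).2.2, .left) →
      LeftMode C C' l r (x - 1) p (Function.update A x ((A x).1, h', (A x).2.2)) md' →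
      LeftInv N C C' a l r (x - 1) (step M N w ⟨.inl (.left md p : Ctl P B), x, tp l r A⟩) := by
    intro md' h' ht hm'
    refine ⟨md', p, _, ?_, by omega,
      hoff.update le_rfl le_rfl hx hr ((A x).1, h', (A x).2.2), ?_, hm'⟩
    · rw [step_inl M N w (by simp) (by simp) ht, update_tp hx hr]
      rfl
    · rw [act_update_same (by rfl), ha]
  rcases md with _ | _ | _ | _
  · exact hm.elim
  · obtain ⟨rfl, hli⟩ := hm
    refine key .done true ?_ ⟨rfl, x, hx, hr, hli.put _⟩
    rw [hread]; simp [ctlTrans]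
  · obtain ⟨rfl, hT, i, h1, h2, hs⟩ := hm
    by_cases hxi : x = i
    · subst hxi
      refine key .pend false ?_ ⟨rfl, ?_⟩
      · rw [hread, hs x]; simp [ctlTrans]
      · rw [hT]; exact hs.liftLeft _
    · refine key .back (A x).2.1 ?_ ⟨rfl, hT, i, h1, by omega, hs.update_same rfl⟩
      rw [hread, hs x]; simp [ctlTrans, hxi]
  · obtain ⟨rfl, i, h1, h2, hs⟩ := hm
    refine key .done (A x).2.1 ?_ ⟨rfl, i, h1, h2, hs.update_same rfl⟩
    rw [hread]; cases (A x).2.1 <;> simp [ctlTrans]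

theorem LeftInv.finish {C C' : TM0.Cfg G P} {a : ℕ} {l r : ℤ}
    {cfg : Config (Ctl P B ⊕ Fin (N + 1)) (Sym G)} (h : LeftInv N C C' a l r (l - 1) cfg) :
    ∃ e : ℕ, e ≤ 1 ∧ ∃ A i,
      (step M N w)^[e] cfg = ⟨.inl (.left .done C'.q), l - e - 1, tp (l - e) r A⟩ ∧
      Off (l - e) r A ∧ act A (l - e) r = a ∧ l - e ≤ i ∧ i < r ∧ Sync A i C'.Tape := by
  obtain ⟨md, p, A, rfl, hr, hoff, ha, hm⟩ := h
  rcases md with _ | _ | _ | _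
  · exact hm.elim
  · obtain ⟨rfl, hli⟩ := hm
    have hA : A (l - 1) = (false, false, default) := hoff _ (by omega)
    refine ⟨1, le_rfl, Function.update A (l - 1) (false, true, default), l - 1, ?_,
      hoff.update (by simp) le_rfl (by simp) hr _, ?_, by simp, hr, ?_⟩
    · have ht : ctlTrans M (.left .pend C'.q : Ctl P B) (tp l r A (l - 1)) =
          (.left .done C'.q, .cell false true default, .left) := by
        rw [tp_apply_notMem (by omega)]; rfl
      rw [Function.iterate_one, step_inl M N w (by simp) (by simp) ht, update_tp_left hr]
      rfl
    · rw [Nat.cast_one, act_succ_left hr, Function.update_self, act_update (by omega),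
        sub_add_cancel, ha]
      simp
    · have := hli.put false
      rwa [hA] at this
  · obtain ⟨-, -, i, h1, h2, -⟩ := hm
    omega
  · obtain ⟨rfl, i, h1, h2, hs⟩ := hm
    refine ⟨0, by simp, A, i, ?_⟩
    simpa using ⟨hoff, ha, h1, h2, hs⟩

end LeftSweep

section RoundTrip

variable {G P : Type} {B : ℕ} [Inhabited G] [Inhabited P]
variable (M : TM0.Machine G P) (N : ℕ) (w : ℕ → G)

/-- The configurations in which a sweep to the right begins: the `k` cells from `l` on hold the
simulated configuration `C`, and `a` of them are active. -/
def Start (C : TM0.Cfg G P) (a : ℕ) (l : ℤ) (k : ℕ)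
    (cfg : Config (Ctl P B ⊕ Fin (N + 1)) (Sym G)) : Prop :=
  ∃ (hB : 0 < B) (A : _) (i : ℤ),
    cfg = ⟨.inl (.right .todo C.q ⟨0, hB⟩ false), l, tp l (l + k) A⟩ ∧
    Off l (l + k) A ∧ act A l (l + k) = a ∧ l ≤ i ∧ i < l + k ∧ Sync A i C.Tape

variable {M N w}

theorem LeftInv.iterate {C C' : TM0.Cfg G P} {a : ℕ} {l r x : ℤ}
    {cfg : Config (Ctl P B ⊕ Fin (N + 1)) (Sym G)} (h : LeftInv N C C' a l r x cfg)
    (n : ℕ) (hn : l ≤ x + 1 - n) : LeftInv N C C' a l r (x - n) ((step M N w)^[n] cfg) := by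
  induction n with
  | zero => simpa using h
  | succ n ih =>
    rw [Function.iterate_succ_apply', Nat.cast_succ, ← sub_sub]
    push_cast at hn
    exact (ih (by omega)).next (by omega)

theorem RightInv.iterate {C C' : TM0.Cfg G P} (hC : TM0.step M C = some C') {a : ℕ} {l r x : ℤ}
    {cfg : Config (Ctl P B ⊕ Fin (N + 1)) (Sym G)} (h : RightInv N C C' a l r x cfg)
    (n : ℕ) (hn : x + n ≤ r) : RightInv N C C' a l r (x + n) ((step M N w)^[n] cfg) := by
  induction n with
  | zero => simpa using h
  | succ n ih =>
    rw [Function.iterate_succ_apply', Nat.cast_succ, ← add_assoc]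
    push_cast at hn
    exact (ih (by omega)).next hC (by omega)

/-- A complete sweep to the left. -/
theorem LeftInv.exists_start (hB : 0 < B) {C C' : TM0.Cfg G P} {a k : ℕ} {l : ℤ}
    {cfg : Config (Ctl P B ⊕ Fin (N + 1)) (Sym G)}
    (h : LeftInv N C C' a l (l + k) (l + k - 1) cfg) :
    ∃ n ≤ k + 2, ∃ l' k', k' ≤ k + 1 ∧ Start N C' a l' k' ((step M N w)^[n] cfg) := by
  have h1 := h.iterate (M := M) (w := w) k (by omega)
  rw [show l + (k : ℤ) - 1 - k = l - 1 by ring] at h1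
  obtain ⟨e, he, A, i, h2, hoff, ha, hi, hi', hs⟩ := h1.finish (M := M) (w := w)
  have hr : l - (e : ℤ) + ((k + e : ℕ) : ℤ) = l + k := by push_cast; ring
  refine ⟨1 + (e + k), by omega, l - e, k + e, by omega, hB, A, i, ?_, ?_⟩
  · rw [Function.iterate_add_apply, Function.iterate_add_apply, h2, Function.iterate_one, hr]
    have ht : ctlTrans M (.left .done C'.q : Ctl P B) (tp (l - e) (l + k) A (l - e - 1)) =
        (.right .todo C'.q ⟨0, hB⟩ false, .blank, .right) := by
      rw [tp_apply_notMem (by omega)]; simp [ctlTrans, hB]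
    rw [step_inl M N w (by simp) (by simp) ht, update_tp_blank (by omega)]
    congr 1
    simp [OneTapeTM.shift]
  · rw [hr]
    exact ⟨hoff, ha, hi, hi', hs⟩

/-- A complete sweep to the right, if the simulated machine does not halt. -/
theorem Start.right_sweep {C C' : TM0.Cfg G P} (hC : TM0.step M C = some C') {a k : ℕ} {l : ℤ}
    {cfg : Config (Ctl P B ⊕ Fin (N + 1)) (Sym G)} (h : Start N C a l k cfg) :
    ∃ n ≤ k + 2, (a = 0 ∧ IsHalt N ((step M N w)^[n] cfg).state) ∨
      (0 < a ∧ ∃ k' ≤ k + 1,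
        LeftInv N C C' (a / B) l (l + (k' : ℕ)) (l + (k' : ℕ) - 1) ((step M N w)^[n] cfg)) := by
  obtain ⟨hB, A, i, rfl, hoff, ha, hi, hi', hs⟩ := h
  have h0 : RightInv N C C' a l (l + k) l
      ⟨.inl (.right .todo C.q ⟨0, hB⟩ false), l, tp l (l + k) A⟩ :=
    ⟨_, _, _, _, _, rfl, le_rfl, hoff, ⟨by simp [act_self, ha], by simp [act_self], by simp⟩,
      rfl, i, hi, hi', hs⟩
  have h1 := h0.iterate (w := w) hC k le_rfl
  obtain ⟨e, he, md, p, c, f, A', h2, hl, hoff', hcl, hmd, hm⟩ := h1.finish (M := M) (w := w)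
  have hr : l + (k : ℤ) + e = l + ((k + e : ℕ) : ℤ) := by push_cast; ring
  refine ⟨1 + (e + k), by omega, ?_⟩
  rw [Function.iterate_add_apply, Function.iterate_add_apply, h2, Function.iterate_one]
  rw [hr] at h2 hoff' hcl hm ⊢
  have ht : ctlTrans M (.right md p c f) (tp l (l + (k + e : ℕ)) A' (l + (k + e : ℕ))) =
      (if f then .left md p else .acc, .blank, .left) := by
    rw [tp_apply_notMem (by omega)]
    rcases hmd with rfl | rfl <;> rfl
  rw [step_inl M N w (by simp) (by simp) ht, update_tp_blank (by omega)]
  have hcount := hcl.count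
  rw [act_self] at hcount
  cases f with
  | false =>
    left
    obtain ⟨h3, h4⟩ := hcl.idle rfl
    refine ⟨?_, by simp [IsHalt]⟩
    rw [← hcount, h3, h4]; simp
  | true =>
    right
    refine ⟨hcl.pos rfl, k + e, by omega, md, p, A', rfl, by omega, hoff', ?_, ?_⟩
    · have := c.isLt
      rw [← hcount, add_zero, Nat.mul_add_div hB, Nat.div_eq_of_lt this, add_zero]
    · rcases hmd with rfl | rfl
      · obtain ⟨h3, h4, j, h5, h6, h7⟩ := hm
        exact ⟨h3, h4, j, h5, by omega, h7⟩
      · exact hm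

/-- If the simulated machine halts, the sweeping machine will never halt. -/
theorem Start.loop {C : TM0.Cfg G P} (hC : TM0.step M C = none) {a k : ℕ} {l : ℤ}
    {cfg : Config (Ctl P B ⊕ Fin (N + 1)) (Sym G)} (h : Start N C a l k cfg) :
    ∃ n, ((step M N w)^[n] cfg).state = .inl .loop := by
  obtain ⟨hB, A, i, rfl, hoff, ha, hi, hi', hs⟩ := h
  have key : ∀ n : ℕ, l + n ≤ i → ∃ c f A',
      (step M N w)^[n] ⟨.inl (.right .todo C.q ⟨0, hB⟩ false), l, tp l (l + k) A⟩ =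
        ⟨.inl (.right .todo C.q c f), l + n, tp l (l + k) A'⟩ ∧ Sync A' i C.Tape := by
    intro n
    induction n with
    | zero => intro _; exact ⟨⟨0, hB⟩, false, A, by simp, hs⟩
    | succ n ih =>
      intro hn
      push_cast at hn
      obtain ⟨c, f, A', h1, h2⟩ := ih (by omega)
      have hx : l + n ≠ i := by omega
      have hA : (A' (l + n)).2.1 = false := by rw [h2]; simp [hx]
      have ht : ctlTrans M (.right .todo C.q c f) (tp l (l + k) A' (l + n)) =
          (.right .todo C.q (sieve c (A' (l + n)).1).1 (f || (A' (l + n)).1),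
            .cell (sieve c (A' (l + n)).1).2 false (A' (l + n)).2.2, .right) := by
        rw [tp_apply_mem (by omega) (by omega), hA]; rfl
      refine ⟨(sieve c (A' (l + n)).1).1, f || (A' (l + n)).1, _, ?_,
        h2.update_same (x := l + n) (b := (sieve c (A' (l + n)).1).2) rfl⟩
      rw [Function.iterate_succ_apply', h1, step_inl M N w (by simp) (by simp) ht,
        update_tp (by omega) (by omega), ← hA]
      congr 1
      simp [OneTapeTM.shift, add_assoc]
  obtain ⟨n, rfl⟩ : ∃ n : ℕ, i = l + n := ⟨(i - l).toNat, by omega⟩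
  obtain ⟨c, f, A', h1, h2⟩ := key n le_rfl
  have hA := h2 (l + n)
  rw [sub_self, Tape.nth_zero] at hA
  have hq : M C.q C.Tape.1 = none := by
    obtain ⟨q, T⟩ := C
    simpa [TM0.step] using hC
  have ht : ctlTrans M (.right .todo C.q c f) (tp l (l + k) A' (l + n)) =
      (.loop, .cell (sieve c (A' (l + n)).1).2 true (A' (l + n)).2.2, .right) := by
    rw [tp_apply_mem (by omega) (by omega), hA]; simp [ctlTrans, hq]
  refine ⟨1 + n, ?_⟩
  rw [Function.iterate_add_apply, h1, Function.iterate_one,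
    step_inl M N w (by simp) (by simp) ht]

theorem exists_step_of_not_dom {C : TM0.Cfg G P}
    (hC : ¬ (StateTransition.eval (TM0.step M) C).Dom) :
    ∃ C', TM0.step M C = some C' ∧ ¬ (StateTransition.eval (TM0.step M) C').Dom := by
  rcases h : TM0.step M C with _ | C'
  · exact absurd (Part.dom_iff_mem.2 ⟨C, StateTransition.mem_eval.2 ⟨.refl, h⟩⟩) hC
  · refine ⟨C', rfl, ?_⟩
    rwa [← StateTransition.reaches_eval (.single h)]

/-- A round trip performs one step of the simulated machine and divides the number of active cells
by `B`. -/
theorem Start.round_trip {C C' : TM0.Cfg G P} (hC : TM0.step M C = some C') {a k : ℕ} {l : ℤ}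
    {cfg : Config (Ctl P B ⊕ Fin (N + 1)) (Sym G)} (h : Start N C a l k cfg) (ha : 0 < a) :
    ∃ n ≤ 2 * (k + 3), ∃ l' k', k' ≤ k + 2 ∧
      Start N C' (a / B) l' k' ((step M N w)^[n] cfg) := by
  have hB := h.1
  obtain ⟨n, hn, h1 | ⟨-, k', hk', h1⟩⟩ := h.right_sweep (w := w) hC
  · omega
  · obtain ⟨n', hn', l'', k'', hk'', h2⟩ := h1.exists_start (M := M) (w := w) hB
    refine ⟨n' + n, by omega, l'', k'', by omega, ?_⟩
    rw [Function.iterate_add_apply]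
    exact h2

/-- If the simulated machine runs forever, then the sieve stops the sweeping machine after about
`log_B a` round trips. -/
theorem Start.halts {C : TM0.Cfg G P} (hC : ¬ (StateTransition.eval (TM0.step M) C).Dom)
    {a k j : ℕ} {l : ℤ} {cfg : Config (Ctl P B ⊕ Fin (N + 1)) (Sym G)} (h : Start N C a l k cfg)
    (ha : a < B ^ j) :
    ∃ n ≤ (j + 1) * (2 * (k + 2 * j + 3)), IsHalt N ((step M N w)^[n] cfg).state := by
  induction j generalizing C a k l cfg with
  | zero =>
    obtain ⟨C', hC', -⟩ := exists_step_of_not_dom hC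
    obtain ⟨n, hn, h1 | ⟨h1, -⟩⟩ := h.right_sweep (w := w) hC'
    · exact ⟨n, by omega, h1.2⟩
    · simp at ha; omega
  | succ j ih =>
    obtain ⟨C', hC', hd⟩ := exists_step_of_not_dom hC
    rcases Nat.eq_zero_or_pos a with h0 | h0
    · obtain ⟨n, hn, h1 | ⟨h1, -⟩⟩ := h.right_sweep (w := w) hC'
      · exact ⟨n, by nlinarith, h1.2⟩
      · omega
    · obtain ⟨n, hn, l', k', hk', h1⟩ := h.round_trip (w := w) hC' h0
      have ha' : a / B < B ^ j := by
        rw [Nat.div_lt_iff_lt_mul h.1, ← pow_succ]; exact ha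
      obtain ⟨n', hn', h2⟩ := ih hd h1 ha'
      refine ⟨n' + n, ?_, by rwa [Function.iterate_add_apply]⟩
      calc n' + n ≤ (j + 1) * (2 * (k + 2 + 2 * j + 3)) + 2 * (k + 2 + 2 * j + 3) := by
            gcongr
            · exact hn'.trans (by gcongr)
            · omega
        _ = _ := by ring

/-- If the simulated machine halts, then the sweeping machine runs forever on all sufficiently
large tapes. -/
theorem exists_start_loops {C : TM0.Cfg G P} (hC : (StateTransition.eval (TM0.step M) C).Dom) :
    ∃ t : ℕ, ∀ (a k : ℕ) (l : ℤ) (cfg : Config (Ctl P B ⊕ Fin (N + 1)) (Sym G)),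
      Start N C a l k cfg → B ^ t ≤ a → ∃ n, ((step M N w)^[n] cfg).state = .inl .loop := by
  obtain ⟨D, hD⟩ := Part.dom_iff_mem.1 hC
  obtain ⟨hr, hn⟩ := StateTransition.mem_eval.1 hD
  clear hC hD
  induction hr using Relation.ReflTransGen.head_induction_on with
  | refl => exact ⟨0, fun a k l cfg h _ => h.loop hn⟩
  | head hstep _ ih =>
    obtain ⟨t, ht⟩ := ih
    refine ⟨t + 1, fun a k l cfg h ha => ?_⟩
    have hB := h.1
    have h0 : 0 < a := (pow_pos hB _).trans_le ha
    obtain ⟨n, -, l', k', -, h1⟩ := h.round_trip (w := w) hstep h0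
    obtain ⟨n', h2⟩ := ht _ _ _ _ h1 (by rwa [Nat.le_div_iff_mul_le hB, ← pow_succ])
    exact ⟨n' + n, by rwa [Function.iterate_add_apply]⟩

end RoundTrip

section Initial

variable {G P : Type} {B : ℕ} [Inhabited G] [Inhabited P]
variable (M : TM0.Machine G P) (N : ℕ) (w : ℕ → G)

/-- The initial configuration on the input of length `n` over a one-letter alphabet. -/
def initial (n : ℕ) : Config (Ctl P B ⊕ Fin (N + 1)) (Sym G) :=
  ⟨.inr 0, 0, fun y => if 0 ≤ y ∧ y < n then .inp else .blank⟩

/-- The contents of the tape after the initial phase. -/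
def initCells (n : ℕ) : ℤ → Bool × Bool × G :=
  fun y => if 0 ≤ y ∧ y < n then (true, decide (y = 0), w y.toNat) else (false, false, default)

/-- The tape during the initial phase, when `x` of `n` letters have been read. -/
def initTape (n x : ℕ) : ℤ → Sym G :=
  fun y => if y < x then tp 0 n (initCells w n) y else
    if 0 ≤ y ∧ y < n then .inp else .blank

/-- The state that reads the letter number `x` in the initial phase. -/
def initState (x : ℕ) : Ctl P B ⊕ Fin (N + 1) :=
  if h : x < N + 1 then .inr ⟨x, h⟩ else .inl .fill

variable {M N w}

theorem initTape_self (n : ℕ) : initTape w n n = tp 0 n (initCells w n) := by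
  funext y
  unfold initTape
  split_ifs with h1 h2
  · rfl
  · omega
  · rw [tp_apply_notMem (by omega)]

theorem iterate_initial (hw : ∀ i, N < i → w i = default) {n x : ℕ} (hx : x ≤ n) :
    (step M N w)^[x] (initial N n : Config (Ctl P B ⊕ Fin (N + 1)) (Sym G)) =
      ⟨initState N x, x, initTape w n x⟩ := by
  induction x with
  | zero =>
    have h0 : initTape w n 0 = fun y : ℤ => if 0 ≤ y ∧ y < n then Sym.inp else .blank := by
      funext y
      unfold initTape
      split_ifs with h1 h2
      · rw [Nat.cast_zero] at h1; omega
      · rw [tp_apply_notMem (by omega)]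
      · rfl
      · rfl
    simp only [Function.iterate_zero, id, initial, initState, Nat.cast_zero]
    rw [dif_pos (by omega), h0]
    rfl
  | succ x ih =>
    rw [Function.iterate_succ_apply', ih (by omega)]
    have hread : initTape w n x (x : ℤ) = .inp := by
      unfold initTape; rw [if_neg (by omega), if_pos (by omega)]
    have hupd : Function.update (initTape w n x) (x : ℤ) (.cell true (decide (x = 0)) (w x)) =
        initTape w n (x + 1) := by
      funext y
      by_cases hy : y = x
      · subst hy
        rw [Function.update_self, initTape, if_pos (by push_cast; omega),
          tp_apply_mem (by omega) (by omega), initCells, if_pos (by omega)]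
        simp
      · rw [Function.update_of_ne hy]
        unfold initTape
        have : y < ((x + 1 : ℕ) : ℤ) ↔ y < x := by push_cast; omega
        simp only [this]
    by_cases hN : x < N + 1
    · rw [step, if_neg (by simp [IsHalt, initState, hN])]
      simp only [initState, hN, dif_pos, trans, hread, chainTrans]
      rw [hupd]
      congr 1
    · have hs : initState N x = (.inl .fill : Ctl P B ⊕ Fin (N + 1)) := dif_neg hN
      have hs' : initState N (x + 1) = (.inl .fill : Ctl P B ⊕ Fin (N + 1)) :=
        dif_neg (by omega)
      have h0 : x ≠ 0 := by omega
      have ht : ctlTrans M (.fill : Ctl P B) (initTape w n x x) =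
          (.fill, .cell true false default, .right) := by rw [hread]; rfl
      rw [hs, hs', step_inl M N w (by simp) (by simp) ht, ← hupd, hw x (by omega)]
      simp [OneTapeTM.shift, h0]

/-- Short inputs are accepted as soon as the first blank has been read. -/
theorem initial_short (hw : ∀ i, N < i → w i = default) {n : ℕ} (hn : n ≤ N) :
    IsHalt N ((step M N w)^[n + 1]
      (initial N n : Config (Ctl P B ⊕ Fin (N + 1)) (Sym G))).state := by
  rw [Function.iterate_succ_apply', iterate_initial hw le_rfl, initTape_self]
  have hs : initState N n = (.inr ⟨n, by omega⟩ : Ctl P B ⊕ Fin (N + 1)) := dif_pos (by omega)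
  rw [hs, step, if_neg (by simp [IsHalt])]
  simp only [trans]
  rw [tp_apply_notMem (by omega)]
  exact .inl rfl

theorem act_initCells (n m : ℕ) (hm : m ≤ n) : act (initCells w n) 0 m = m := by
  induction m with
  | zero => simp [act_self]
  | succ m ih =>
    rw [Nat.cast_succ, act_succ_right (by omega), ih (by omega)]
    have : (initCells w n m).1 = true := by rw [initCells, if_pos (by omega)]
    rw [this]; rfl

/-- On long inputs, the simulation starts after `2 n + O(1)` steps. -/
theorem initial_long (hB : 0 < B) (hw : ∀ i, N < i → w i = default) {T : Tape G}
    (hT : ∀ y : ℤ, T.nth y = if 0 ≤ y then w y.toNat else default) {n : ℕ} (hn : N < n) :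
    ∃ m ≤ 2 * n + 3, ∃ l k, k ≤ n + 1 ∧
      Start N ⟨default, T⟩ n l k ((step M N w)^[m]
        (initial N n : Config (Ctl P B ⊕ Fin (N + 1)) (Sym G))) := by
  have h1 := iterate_initial (M := M) (P := P) (B := B) hw (le_refl n)
  have hs : initState N n = (.inl .fill : Ctl P B ⊕ Fin (N + 1)) := dif_neg (by omega)
  have ht : ctlTrans M (.fill : Ctl P B) (tp 0 n (initCells w n) n) =
      (.left .done default, .blank, .left) := by
    rw [tp_apply_notMem (by omega)]; rfl
  have h2 : (step M N w)^[1 + n] (initial N n : Config (Ctl P B ⊕ Fin (N + 1)) (Sym G)) =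
      ⟨.inl (.left .done default), n - 1, tp 0 n (initCells w n)⟩ := by
    rw [Function.iterate_add_apply, h1, initTape_self, hs, Function.iterate_one,
      step_inl M N w (by simp) (by simp) ht, update_tp_blank (by omega)]
    rfl
  have h3 : LeftInv N ⟨default, T⟩ ⟨default, T⟩ n 0 (0 + n) (0 + n - 1)
      ((step M N w)^[1 + n] (initial N n : Config (Ctl P B ⊕ Fin (N + 1)) (Sym G))) := by
    rw [zero_add]
    refine ⟨_, _, _, h2, by omega, fun y hy => if_neg hy, act_initCells n n le_rfl, rfl, 0, le_rfl,
      by omega, fun y => ?_⟩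
    rw [sub_zero, hT, initCells]
    split_ifs with h4 h5 h5
    · rfl
    · omega
    · have : y ≠ 0 := by omega
      rw [hw _ (by omega)]; simp [this]
    · have : y ≠ 0 := by omega
      simp [this]
  obtain ⟨m, hm, l, k, hk, h4⟩ := h3.exists_start (M := M) (w := w) hB
  exact ⟨m + (1 + n), by omega, l, k, hk, by rwa [Function.iterate_add_apply]⟩

end Initial

end Sweep

/-! ### The sweeping machine as a one-tape Turing machine, and its description -/

namespace Sweep

open Turing

section Machine

variable {G P : Type} {B : ℕ} [Inhabited G] [Inhabited P]
variable (M : TM0.Machine G P) (N : ℕ) (w : ℕ → G) {K S : ℕ}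
  (eC : Ctl P B ≃ Fin K) (eS : Sym G ≃ Fin S)

/-- The numbering of the states: first those of `Ctl`, then those of the initial phase. -/
def stateEquiv : Ctl P B ⊕ Fin (N + 1) ≃ Fin (K + (N + 1)) :=
  (Equiv.sumCongr eC (Equiv.refl _)).trans finSumFinEquiv

/-- The sweeping machine as a one-tape Turing machine; its input alphabet has one letter. -/
def machine : OneTapeTM where
  numStates := K + (N + 1)
  numSymbols := S
  inputAlphabet := {eS .inp}
  blank := eS .blank
  δ q a :=
    let r := trans M N w ((stateEquiv N eC).symm q) (eS.symm a)
    (stateEquiv N eC r.1, eS r.2.1, r.2.2)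
  start := stateEquiv N eC (.inr 0)
  accept := stateEquiv N eC (.inl .acc)
  reject := stateEquiv N eC (.inl .rej)
  inputAlphabet_nonempty := ⟨_, Finset.mem_singleton_self _⟩
  blank_notMem := by simp
  start_ne_accept := by simp
  start_ne_reject := by simp
  accept_ne_reject := by simp

/-- The letter of the input alphabet of `machine`. -/
def letter : Fin (machine M N w eC eS).numSymbols := eS .inp

/-- The configuration of `machine` that corresponds to a configuration with unnumbered states and
symbols. -/
def embed (c : Config (Ctl P B ⊕ Fin (N + 1)) (Sym G)) : (machine M N w eC eS).Cfg where
  state := stateEquiv N eC c.state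
  head := c.head
  tape y := eS (c.tape y)

theorem halted_embed (c : Config (Ctl P B ⊕ Fin (N + 1)) (Sym G)) :
    (machine M N w eC eS).Halted (embed M N w eC eS c) ↔ IsHalt N c.state :=
  or_congr (stateEquiv N eC).injective.eq_iff (stateEquiv N eC).injective.eq_iff

theorem step_embed (c : Config (Ctl P B ⊕ Fin (N + 1)) (Sym G)) :
    (machine M N w eC eS).step (embed M N w eC eS c) = embed M N w eC eS (step M N w c) := by
  by_cases h : IsHalt N c.state
  · rw [step_halt M N w h, OneTapeTM.step, if_pos ((halted_embed M N w eC eS c).2 h)]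
  · rw [step, if_neg h, OneTapeTM.step, if_neg (mt (halted_embed M N w eC eS c).1 h)]
    simp only [embed, machine, Equiv.symm_apply_apply]
    congr 1
    funext y
    by_cases hy : y = c.head
    · subst hy; simp
    · simp [hy]

theorem iterate_step_embed (k : ℕ) (c : Config (Ctl P B ⊕ Fin (N + 1)) (Sym G)) :
    (machine M N w eC eS).step^[k] (embed M N w eC eS c) =
      embed M N w eC eS ((step M N w)^[k] c) :=
  (Function.Semiconj.iterate_right (fun c => (step_embed M N w eC eS c).symm) k c).symm

theorem init_replicate (n : ℕ) :
    (machine M N w eC eS).init (List.replicate n (letter M N w eC eS)) =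
      embed M N w eC eS (initial N n) := by
  simp only [OneTapeTM.init, embed, initial]
  congr 1
  funext y
  simp only [OneTapeTM.initTape]
  by_cases h0 : 0 ≤ y
  · by_cases hn : y < n
    · have : y.toNat < n := by omega
      rw [if_pos h0, if_pos ⟨h0, hn⟩, List.getD_eq_getElem _ _ (by simpa using this),
        List.getElem_replicate]
      rfl
    · have : n ≤ y.toNat := by omega
      rw [if_pos h0, if_neg (by omega), List.getD_eq_default _ _ (by simpa using this)]
      rfl
  · rw [if_neg h0, if_neg (by omega)]
    rfl

theorem runsInTime_machine (T : ℕ → ℝ≥0) :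
    (machine M N w eC eS).RunsInTime T ↔ ∀ n, ∃ k : ℕ, (k : ℝ≥0) ≤ T n ∧
      IsHalt N ((step M N w)^[k]
        (initial N n : Config (Ctl P B ⊕ Fin (N + 1)) (Sym G))).state := by
  constructor
  · intro h n
    obtain ⟨k, hk, hh⟩ := h (List.replicate n (letter M N w eC eS)) fun a ha => by
      rw [List.eq_of_mem_replicate ha]; exact Finset.mem_singleton_self _
    rw [List.length_replicate] at hk
    refine ⟨k, hk, ?_⟩
    rwa [init_replicate, iterate_step_embed, halted_embed] at hh
  · intro h u hu
    have hu' : u = List.replicate u.length (letter M N w eC eS) :=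
      List.eq_replicate_of_mem fun a ha => Finset.mem_singleton.1 (hu a ha)
    obtain ⟨k, hk, hh⟩ := h u.length
    refine ⟨k, hk, ?_⟩
    rw [hu', init_replicate, iterate_step_embed, halted_embed]
    exact hh

end Machine

section Encoding

variable {G P : Type} {B : ℕ} [Inhabited G]
variable {K S : ℕ} (eC : Ctl P B ≃ Fin K) (eS : Sym G ≃ Fin S)

/-- The word `abc^m`, continued with blanks. -/
def word (a b c : G) (m i : ℕ) : G :=
  if i = 0 then a else if i = 1 then b else if i < m + 2 then c else default

/-- A row of the transition table that belongs to the initial phase. -/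
def chainRow (n₀ : ℕ) (a b c : G) (m i : ℕ) : List (ℕ × ℕ × Bool) :=
  List.ofFn fun s : Fin S => match eS.symm s with
    | .inp => (if i + 1 < n₀ + m + 3 then K + (i + 1) else (eC .fill : ℕ),
        if i = 0 then (eS (.cell true true a) : ℕ)
          else if i = 1 then (eS (.cell true false b) : ℕ)
          else if i < m + 2 then (eS (.cell true false c) : ℕ)
          else (eS (.cell true false default) : ℕ), true)
    | _ => (eC .acc, s, true)

theorem primrec_chainRow (n₀ : ℕ) (a b c : G) : Primrec₂ (chainRow eC eS n₀ a b c) := by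
  refine Primrec.list_ofFn (f := fun (s : Fin S) (p : ℕ × ℕ) => match eS.symm s with
    | .inp => (if p.2 + 1 < n₀ + p.1 + 3 then K + (p.2 + 1) else (eC .fill : ℕ),
        if p.2 = 0 then (eS (.cell true true a) : ℕ)
          else if p.2 = 1 then (eS (.cell true false b) : ℕ)
          else if p.2 < p.1 + 2 then (eS (.cell true false c) : ℕ)
          else (eS (.cell true false default) : ℕ), true)
    | _ => ((eC .acc : ℕ), (s : ℕ), true)) fun s => ?_
  have hi : Primrec fun p : ℕ × ℕ => p.2 := Primrec.snd
  have hm : Primrec fun p : ℕ × ℕ => p.1 := Primrec.fst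
  rcases eS.symm s with _ | _ | _
  · exact Primrec.const _
  · refine Primrec.pair (Primrec.ite ?_ ?_ (Primrec.const _)) (Primrec.pair
      (Primrec.ite ?_ (Primrec.const _) (Primrec.ite ?_ (Primrec.const _)
        (Primrec.ite ?_ (Primrec.const _) (Primrec.const _)))) (Primrec.const _))
    · exact Primrec.nat_lt.comp (Primrec.nat_add.comp hi (Primrec.const 1))
        (Primrec.nat_add.comp (Primrec.nat_add.comp (Primrec.const n₀) hm) (Primrec.const 3))
    · exact Primrec.nat_add.comp (Primrec.const K) (Primrec.nat_add.comp hi (Primrec.const 1))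
    · exact Primrec.eq.comp hi (Primrec.const 0)
    · exact Primrec.eq.comp hi (Primrec.const 1)
    · exact Primrec.nat_lt.comp hi (Primrec.nat_add.comp hm (Primrec.const 2))
  · exact Primrec.const _

theorem ofFn_val_eq_map_range {α : Type*} (n : ℕ) (f : ℕ → α) :
    (List.ofFn fun i : Fin n => f i) = (List.range n).map f := by
  apply List.ext_getElem <;> simp

/-- The description of a transition, with states and symbols replaced by their numbers. -/
def transCode (N : ℕ) (r : (Ctl P B ⊕ Fin (N + 1)) × Sym G × Dir) : ℕ × ℕ × Bool :=
  (stateEquiv N eC r.1, eS r.2.1, decide (r.2.2 = Dir.right))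

/-- The rows of the transition table that do not belong to the initial phase. They are the same
for all initial words. -/
def ctlRows [Inhabited P] (M : TM0.Machine G P) : List (List (ℕ × ℕ × Bool)) :=
  List.ofFn fun q : Fin K => List.ofFn fun s : Fin S =>
    let r := ctlTrans M (eC.symm q) (eS.symm s)
    ((eC r.1 : ℕ), (eS r.2.1 : ℕ), decide (r.2.2 = Dir.right))

theorem table_eq [Inhabited P] (M : TM0.Machine G P) (n₀ : ℕ) (a b c : G) (m : ℕ) :
    List.ofFn (fun q : Fin (K + (n₀ + m + 3)) => List.ofFn fun s : Fin S =>
      transCode eC eS (n₀ + m + 2) (trans M (n₀ + m + 2) (word a b c m)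
        ((stateEquiv (n₀ + m + 2) eC).symm q) (eS.symm s))) =
      ctlRows eC eS M ++ (List.range (n₀ + m + 3)).map (chainRow eC eS n₀ a b c m) := by
  rw [List.ofFn_add, ← ofFn_val_eq_map_range]
  congr 1
  · rw [ctlRows]
    congr 1
    funext q
    congr 1
    funext s
    have hq : ∀ h, (stateEquiv (n₀ + m + 2) eC).symm (Fin.castLE h q) = .inl (eC.symm q) := by
      intro h
      rw [Equiv.symm_apply_eq]
      ext
      simp [stateEquiv]
    rw [hq]
    exact Prod.ext (by simp [transCode, trans, stateEquiv]) rfl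
  · congr 1
    funext i
    rw [chainRow]
    congr 1
    funext s
    have hq : (stateEquiv (n₀ + m + 2) eC).symm (Fin.natAdd K i) = .inr i := by
      rw [Equiv.symm_apply_eq]; simp [stateEquiv]
    rw [hq]
    simp only [trans, transCode]
    rcases hs : eS.symm s with _ | _ | _
    · simp [chainTrans, stateEquiv, ← hs]
    · simp only [chainTrans, word]
      refine Prod.ext ?_ (Prod.ext ?_ (by simp))
      · simp only
        split_ifs <;> simp [stateEquiv]
      · simp only
        split_ifs with h1 h2 h3 <;> simp_all
    · simp [chainTrans, stateEquiv, ← hs]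

theorem encode_machine [Inhabited P] (M : TM0.Machine G P) (n₀ : ℕ) (a b c : G) (m : ℕ) :
    (machine M (n₀ + m + 2) (word a b c m) eC eS).encode =
      (K + (n₀ + m + 3), S, List.ofFn (fun s : Fin S => decide (s = eS .inp)), (eS .blank : ℕ),
        ctlRows eC eS M ++ (List.range (n₀ + m + 3)).map (chainRow eC eS n₀ a b c m),
        K, (eC .acc : ℕ), (eC .rej : ℕ)) := by
  have hacc : ((stateEquiv (n₀ + m + 2) eC (.inl .acc)) : ℕ) = eC .acc := by simp [stateEquiv]
  have hrej : ((stateEquiv (n₀ + m + 2) eC (.inl .rej)) : ℕ) = eC .rej := by simp [stateEquiv]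
  have hst : ((stateEquiv (n₀ + m + 2) eC (.inr 0)) : ℕ) = K := by simp [stateEquiv]
  refine Prod.ext rfl (Prod.ext rfl (Prod.ext ?_ (Prod.ext rfl (Prod.ext ?_
    (Prod.ext hst (Prod.ext hacc hrej))))))
  · exact congrArg List.ofFn (funext fun s => decide_eq_decide.2 Finset.mem_singleton)
  · exact table_eq eC eS M n₀ a b c m

/-- The description of the sweeping machine is computable from the length of the simulated input:
only the rows of the initial phase depend on it. -/
theorem computable_encode_machine [Inhabited P] (M : TM0.Machine G P) (n₀ : ℕ) (a b c : G) :
    Computable fun m : ℕ => (machine M (n₀ + m + 2) (word a b c m) eC eS).encode := by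
  refine Primrec.to_comp (Primrec.of_eq ?_ fun m => (encode_machine eC eS M n₀ a b c m).symm)
  have hN : Primrec fun m : ℕ => n₀ + m + 3 :=
    Primrec.nat_add.comp (Primrec.nat_add.comp (Primrec.const n₀) Primrec.id) (Primrec.const 3)
  refine Primrec.pair (Primrec.nat_add.comp (Primrec.const K) hN) (Primrec.pair (Primrec.const _)
    (Primrec.pair (Primrec.const _) (Primrec.pair (Primrec.const _) (Primrec.pair ?_
      (Primrec.const _)))))
  exact Primrec.list_append.comp (Primrec.const _)
    (Primrec.list_map (Primrec.list_range.comp hN) (primrec_chainRow eC eS n₀ a b c))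

end Encoding

end Sweep

/-! ### The time bound and the reduction -/

namespace Sweep

open Turing

/-- The base of the sieve may be chosen so large that the running time of the sweeping machine is
below any given multiple of `n log n`. -/
theorem exists_time_bound {κ : ℝ} (hκ : 0 < κ) :
    ∃ B n₁ : ℕ, 1 < B ∧ ∀ n ≥ n₁, ∃ j, n < B ^ j ∧
      (((2 * n + 3) + (j + 1) * (2 * ((n + 1) + 2 * j + 3)) : ℕ) : ℝ) ≤
        κ * (n * Real.logb 2 n) := by
  -- the time will turn out to be at most `33 n + 14 n log_B n`; either summand is to be at most
  -- half of `κ n log₂ n`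
  obtain ⟨b, hb⟩ := exists_nat_gt (28 / κ)
  obtain ⟨e, he⟩ := exists_nat_gt (66 / κ)
  have hb0 : (0 : ℝ) < b := (by positivity : (0 : ℝ) < 28 / κ).trans hb
  have hb1 : 0 < b := by exact_mod_cast hb0
  have hB : 1 < 2 ^ b := Nat.one_lt_two_pow (by omega)
  refine ⟨2 ^ b, 2 ^ e, hB, fun n hn => ?_⟩
  have hn0 : 0 < n := (by positivity : 0 < 2 ^ e).trans_le hn
  have hn1 : (1 : ℝ) ≤ n := by exact_mod_cast hn0
  refine ⟨Nat.log (2 ^ b) n + 1, Nat.lt_pow_succ_log_self hB n, ?_⟩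
  set i := Nat.log (2 ^ b) n with hi
  set L := Real.logb 2 n with hL
  have hin : i < n := Nat.log_lt_self _ hn0.ne'
  have hin' : (i : ℝ) + 1 ≤ n := by exact_mod_cast hin
  have hiL : (b : ℝ) * i ≤ L := by
    rw [hL, Real.le_logb_iff_rpow_le one_lt_two (by positivity)]
    have : (2 ^ b) ^ i ≤ n := Nat.pow_log_le_self _ hn0.ne'
    rw [← pow_mul] at this
    rw [← Nat.cast_mul, Real.rpow_natCast]
    exact_mod_cast this
  have heL : (e : ℝ) ≤ L := by
    rw [hL, Real.le_logb_iff_rpow_le one_lt_two (by positivity), Real.rpow_natCast]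
    exact_mod_cast hn
  have hL0 : 0 ≤ L := (Nat.cast_nonneg e).trans heL
  have h1 : 28 * (i : ℝ) ≤ κ * L := by
    rw [div_lt_iff₀ hκ] at hb
    calc 28 * (i : ℝ) ≤ b * κ * i := by gcongr
      _ = κ * (b * i) := by ring
      _ ≤ κ * L := by gcongr
  have h2 : 66 ≤ κ * L := by
    rw [div_lt_iff₀ hκ] at he
    nlinarith
  have h3 : 2 * (((n : ℝ) + 1) + 2 * (i + 1) + 3) ≤ 14 * n := by linarith
  push_cast
  calc (2 * (n : ℝ) + 3) + ((i + 1) + 1) * (2 * ((n + 1) + 2 * (i + 1) + 3))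
      ≤ 5 * n + ((i + 1) + 1) * (14 * n) := by
        gcongr ?_ + ((i + 1) + 1) * ?_
        linarith
    _ = n * (33 + 14 * i) := by ring
    _ ≤ n * (κ * L) := by gcongr; linarith
    _ = κ * (n * L) := by ring

theorem word_eq_getI {G : Type} [Inhabited G] (a b c : G) (m i : ℕ) :
    (a :: b :: List.replicate m c).getI i = word a b c m i := by
  unfold word
  rcases i with _ | _ | i
  · simp
  · simp
  · rw [if_neg (by omega), if_neg (by omega), List.getI_cons_succ, List.getI_cons_succ]
    split_ifs with h
    · rw [List.getI_eq_getElem _ (by simp; omega), List.getElem_replicate]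
    · rw [List.getI_eq_default _ (by simp; omega)]

theorem nth_mk₁ {G : Type} [Inhabited G] (l : List G) (y : ℤ) :
    (Tape.mk₁ l).nth y = if 0 ≤ y then l.getI y.toNat else default := by
  rcases y with n | n
  · rw [if_pos (by simp)]
    exact (Tape.mk'_nth_nat _ _ n).trans (ListBlank.nth_mk _ _)
  · rw [if_neg (by simp)]
    change (ListBlank.mk ([] : List G)).nth n = _
    rw [ListBlank.nth_mk, List.getI_nil]

/-- Correctness of the reduction: the sweeping machine runs in time `T(n)` if and only if
the simulated machine does not halt. -/
theorem runsInTime_iff_not_dom {G P : Type} [Inhabited G] [Inhabited P] (M : TM0.Machine G P)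
    (a b c : G) {B n₁ : ℕ} (hB : 1 < B) {T : ℕ → ℝ≥0} (hT : ∀ n : ℕ, (n : ℝ≥0) + 1 ≤ T n)
    (hn₁ : ∀ n ≥ n₁, ∃ j, n < B ^ j ∧
      (((2 * n + 3) + (j + 1) * (2 * ((n + 1) + 2 * j + 3)) : ℕ) : ℝ) ≤ T n)
    {K S : ℕ} (eC : Ctl P B ≃ Fin K) (eS : Sym G ≃ Fin S) (m : ℕ) :
    (machine M (n₁ + m + 2) (word a b c m) eC eS).RunsInTime T ↔
      ¬ (TM0.eval M (a :: b :: List.replicate m c)).Dom := by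
  have hw : ∀ i, n₁ + m + 2 < i → word a b c m i = default := fun i hi => by
    rw [word, if_neg (by omega), if_neg (by omega), if_neg (by omega)]
  have hnth : ∀ y : ℤ, (Tape.mk₁ (a :: b :: List.replicate m c)).nth y =
      if 0 ≤ y then word a b c m y.toNat else default := fun y => by
    rw [nth_mk₁, word_eq_getI]
  rw [runsInTime_machine]
  constructor
  · intro h hdom
    -- an input so long that the initial phase is passed and the sieve outlasts the halting of `M`
    obtain ⟨t, ht⟩ := exists_start_loops (N := n₁ + m + 2) (w := word a b c m) (B := B)
      (C := TM0.init (a :: b :: List.replicate m c)) hdom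
    obtain ⟨r, -, l, k, -, hs⟩ := initial_long (M := M) (B := B) (by omega) hw hnth
      (n := B ^ t + (n₁ + m + 2) + 1) (by omega)
    obtain ⟨r', hr'⟩ := ht _ _ _ _ hs (by omega)
    obtain ⟨k', -, hk'⟩ := h (B ^ t + (n₁ + m + 2) + 1)
    rw [← Function.iterate_add_apply] at hr'
    -- a halting configuration would persist, and so would the state `loop`
    have h1 := iterate_step_loop M (n₁ + m + 2) (word a b c m) hr' k'
    rw [← Function.iterate_add_apply, iterate_step_halt M _ _ (by omega) hk'] at h1
    rw [h1] at hk'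
    simp [IsHalt] at hk'
  · intro hdom n
    rcases le_or_gt n (n₁ + m + 2) with hn | hn
    · exact ⟨n + 1, by exact_mod_cast hT n, initial_short hw hn⟩
    · obtain ⟨r, hr, l, k, hk, hs⟩ := initial_long (M := M) (B := B) (by omega) hw hnth hn
      obtain ⟨j, hj, hjT⟩ := hn₁ n (by omega)
      obtain ⟨r', hr', hh⟩ := hs.halts (w := word a b c m) hdom hj
      refine ⟨r' + r, ?_, by rwa [Function.iterate_add_apply]⟩
      rw [← NNReal.coe_le_coe, NNReal.coe_natCast]
      refine le_trans (Nat.cast_le.2 ?_) hjT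
      have : (j + 1) * (2 * (k + 2 * j + 3)) ≤ (j + 1) * (2 * ((n + 1) + 2 * j + 3)) := by
        gcongr
      omega

end Sweep

theorem mainTheorem2 (T : ℕ → ℝ≥0)
    (hΩ : IsBigOmega T (fun n => n * Real.logb 2 n))
    (hT : ∀ n : ℕ, (n : ℝ≥0) + 1 ≤ T n) :
    ¬ DecidableProblem (HALT₁ T) := by
  rintro ⟨f, hf, hdec⟩
  obtain ⟨κ, hκ, n₀, hn₀⟩ := hΩ
  obtain ⟨B, n₁, hB, hbound⟩ := Sweep.exists_time_bound hκ
  obtain ⟨G, P, hG, iG, hP, iP, M, a, b, c, hnc⟩ := exists_TM0_halting_not_computable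
  have := Fintype.ofFinite G
  have := Fintype.ofFinite P
  let eC := Fintype.equivFin (Sweep.Ctl P B)
  let eS := Fintype.equivFin (Sweep.Sym G)
  let N := max n₀ n₁
  let W : ℕ → OneTapeTM := fun m => Sweep.machine M (N + m + 2) (Sweep.word a b c m) eC eS
  have hW : ∀ m, W m ∈ HALT₁ T ↔ ¬ (Turing.TM0.eval M (a :: b :: List.replicate m c)).Dom :=
    fun m => Sweep.runsInTime_iff_not_dom M a b c hB hT (fun n hn => by
      obtain ⟨j, hj, h⟩ := hbound n (le_trans (le_max_right _ _) hn)
      exact ⟨j, hj, h.trans (hn₀ n (le_trans (le_max_left _ _) hn))⟩) eC eS m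
  choose g hg hg' using fun m => hdec (W m)
  have hgc : Computable g :=
    Partrec.of_eq_tot (hf.comp (Sweep.computable_encode_machine eC eS M N a b c)) hg
  refine hnc (ComputablePred.computable_iff.2 ⟨fun m => !g m, Primrec.not.to_comp.comp hgc, ?_⟩)
  funext m
  have h1 := (hg' m).trans (hW m)
  refine propext ?_
  cases hgm : g m <;> simpa [hgm] using h1
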